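/- Let $\Gamma$ be a finite rooted tree, with root $x_0$ and its edges directed away from the root. For a vertex $x$ let the level $\ell_\Gamma(x)$ be the length of the directed path from $x_0$ to $x$, let $\deg^+_\Gamma(x)$ be the number of edges directed away from $x$, and let $\operatorname{ht}(\Gamma)=\max_x \ell_\Gamma(x)$. Suppose that $\Gamma$ is perfect, that is, every leaf (vertex with $\deg^+_\Gamma(x)=0$) has level $\operatorname{ht}(\Gamma)$, and that $\operatorname{ht}(\Gamma)\ge 1$. Put $t=\operatorname{ht}(\Gamma)+1$. Let $\mathsf k$ be a field, let $R$ be the standard graded polynomial ring over $\mathsf k$ whose variables are the vertices of $\Gamma$, and let $I_t(\Gamma)\subseteq R$ be the ideal generated by the monomials $x_{i_1}\cdots x_{i_t}$ such that $x_{i_1},\dots,x_{i_t}$ is a directed path on $t$ vertices of $\Gamma$. Then $$\operatorname{reg}\bigl(R/I_t(\Gamma)\bigr)=1+\sum_{0\le \ell_\Gamma(x)\le \operatorname{ht}(\Gamma)-2}\deg^+_\Gamma(x),$$ where the sum is over all vertices $x$ of level at most $\operatorname{ht}(\Gamma)-2$ (so it is $0$ if $\operatorname{ht}(\Gamma)=1$).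 Here $\operatorname{reg}(R/I)=\max\{j-i:\beta_{i,j}(R/I)\ne 0\}$, where $\beta_{i,j}(R/I)$ is the number of copies of $R(-j)$ in homological degree $i$ of the minimal graded free resolution of $R/I$. -/

import Mathlib

open scoped BigOperators

namespace PathIdeal

/-! ### Rooted trees -/

/-- A rooted tree on the vertex set `V`: a tree together with a distinguished vertex. -/
structure RootedTree (V : Type*) where
  graph : SimpleGraph V
  isTree : graph.IsTree
  root : V

namespace RootedTree

variable {V : Type*} (Γ : RootedTree V)

/-- The level of `x`: the length of the path from the root to `x`. -/
noncomputable def level (x : V) : ℕ := Γ.graph.dist Γ.root x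

/-- `x → y` is a directed edge: the edges of the tree are directed away from the root. -/
def DirEdge (x y : V) : Prop := Γ.graph.Adj x y ∧ Γ.level y = Γ.level x + 1

/-- The number of edges directed away from `x`. -/
noncomputable def outdegree (x : V) : ℕ := Set.ncard {y | Γ.DirEdge x y}

/-- A leaf is a vertex of outdegree `0`. -/
def IsLeaf (x : V) : Prop := Γ.outdegree x = 0

/-- The height of a finite rooted tree: the maximal level of a vertex. -/
noncomputable def height [Fintype V] : ℕ := Finset.univ.sup Γ.level

/-- A rooted tree is perfect if all its leaves have level equal to the height. -/
def IsPerfect [Fintype V] : Prop := ∀ x, Γ.IsLeaf x → Γ.level x = Γ.height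

/-- The sequence `p 0, …, p (t - 1)` is a directed path on `t` (distinct) vertices. -/
def IsDirPath {t : ℕ} (p : Fin t → V) : Prop :=
  Function.Injective p ∧ ∀ i j : Fin t, (j : ℕ) = (i : ℕ) + 1 → Γ.DirEdge (p i) (p j)

/-- The `t`-path ideal in the polynomial ring over `k` with one variable per vertex: it is
generated by the products of the vertices of the directed paths on `t` vertices. -/
noncomputable def pathIdeal (k : Type*) [Field k] (t : ℕ) : Ideal (MvPolynomial V k) :=
  Ideal.span {m | ∃ p : Fin t → V, Γ.IsDirPath p ∧ m = ∏ i, MvPolynomial.X (p i)}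

end RootedTree

/-! ### Minimal graded free resolutions and regularity -/

section Regularity

variable {σ k : Type*} [Field k]

/-- `p` is homogeneous of degree `n`, with `n` an integer, for the standard grading of the
polynomial ring. The zero polynomial is homogeneous of every degree, and it is the only one
which is homogeneous of a negative degree. -/
def IsHomogeneousOfDegree (p : MvPolynomial σ k) (n : ℤ) : Prop :=
  ∀ e ∈ p.support, (e.degree : ℤ) = n

/-- The degree-`n` component of the graded module `R/I`: the classes of the homogeneous
polynomials of degree `n`. -/
def quotientComponent (I : Ideal (MvPolynomial σ k)) (n : ℤ) : Set (MvPolynomial σ k ⧸ I) :=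
  {m | ∃ p : MvPolynomial σ k, IsHomogeneousOfDegree p n ∧ Ideal.Quotient.mk I p = m}

/-- A minimal graded free resolution `⋯ → F₁ → F₀ → R/I → 0` of `R/I`, for a homogeneous ideal
`I` of `R = k[x_s : s ∈ σ]`. Here `F i` is the free module with basis `e_a`, `a : Fin (rank i)`,
where `e_a` has degree `deg i a`; so `F i = ⊕ₐ R(-deg i a)`. -/
structure MinimalGradedFreeResolution (I : Ideal (MvPolynomial σ k)) where
  rank : ℕ → ℕ
  deg : ∀ i, Fin (rank i) → ℤ
  d : ∀ i, (Fin (rank (i + 1)) → MvPolynomial σ k) →ₗ[MvPolynomial σ k]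
    (Fin (rank i) → MvPolynomial σ k)
  aug : (Fin (rank 0) → MvPolynomial σ k) →ₗ[MvPolynomial σ k] (MvPolynomial σ k ⧸ I)
  /-- The augmentation preserves degrees. -/
  aug_homogeneous : ∀ a, aug (Pi.single a 1) ∈ quotientComponent I (deg 0 a)
  /-- The differentials preserve degrees: the coefficient of `e_b` in the image of `e_a` is
  homogeneous of degree `deg e_a - deg e_b`. -/
  d_homogeneous : ∀ i a b,
    IsHomogeneousOfDegree (d i (Pi.single a 1) b) (deg (i + 1) a - deg i b)
  aug_surjective : Function.Surjective aug
  exact_aug : Function.Exact (d 0) aug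
  exact_d : ∀ i, Function.Exact (d (i + 1)) (d i)
  /-- Minimality: the image of `F (i + 1)` lies in `𝔪 F i`, with `𝔪` generated by the variables. -/
  minimal : ∀ i, LinearMap.range (d i) ≤
    Ideal.span (Set.range (MvPolynomial.X : σ → MvPolynomial σ k)) •
      (⊤ : Submodule (MvPolynomial σ k) (Fin (rank i) → MvPolynomial σ k))

/-- The graded Betti number `β i j`: the number of copies of `R(-j)` in the `i`-th free module. -/
def MinimalGradedFreeResolution.betti {I : Ideal (MvPolynomial σ k)}
    (F : MinimalGradedFreeResolution I) (i : ℕ) (j : ℤ) : ℕ :=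
  Fintype.card {a : Fin (F.rank i) // F.deg i a = j}

/-- `reg (R/I) = r`: a minimal graded free resolution of `R/I` exists, and, for any such
resolution, `r` is the maximum of all `j - i` with `β i j ≠ 0`. -/
def HasRegularity (I : Ideal (MvPolynomial σ k)) (r : ℤ) : Prop :=
  Nonempty (MinimalGradedFreeResolution I) ∧
    ∀ F : MinimalGradedFreeResolution I,
      IsGreatest {s : ℤ | ∃ (i : ℕ) (j : ℤ), F.betti i j ≠ 0 ∧ s = j - (i : ℤ)} r

end Regularity

end PathIdeal

/-!
# Regularity of the path ideal of a perfect rooted tree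

Levels increase by one along a directed path, so a directed path on `ht + 1` vertices runs from the
root to a vertex of maximal level, and it is determined by its last vertex, because a vertex has
only one parent (`DirEdge.left_unique`). The path ideal therefore has one squarefree generator for
each vertex of maximal level, and this vertex divides no other generator
(`FullPath.eq_of_last_mem`).

For any monomial ideal, the Taylor complex, with one basis element for each set `S` of generators,
placed in homological degree `|S|` and in internal degree `deg lcm S`, is a free resolution:
multiplying the basis element of `S` by `lcm S` identifies it with a subcomplex of the augmented
simplex on the generators, and in each multidegree this subcomplex is the full simplex on the
generators dividing the given monomial, hence a cone (`exists_taylorMap_eq`). It is minimal as soon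
as no generator divides the least common multiple of others (`taylorResolution`), which holds here.

Graded Betti numbers do not depend on the minimal resolution (`betti_eq`): by induction on the
homological degree, both free modules are minimal graded covers of the same module, and such covers
are isomorphic by a degree-preserving map (`exists_graded_equiv_of_minimal_covers`).

So the regularity is the maximum of `|⋃ S| - |S|` over the sets `S` of full paths
(`hasRegularity_monomialIdeal`). A union of `|S|` paths has at most `|S|` vertices of maximal level,
so the difference is at most the number of vertices of non-maximal level. In a perfect tree the set
of all paths attains this bound, since every vertex lies on one of them. Finally, the vertices of
non-maximal level are the root and the children of the vertices of level at most `ht - 2`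
(`card_level_lt_height`).
-/

namespace PathIdeal

/-! ### The augmented simplex -/

section Simplex

variable {L : Type*} [LinearOrder L]

/-- The incidence sign between `S` and `insert s S`: minus one to the number of elements of `S`
below `s`. It does not depend on whether `s` belongs to `S`. -/
def incidenceSign (s : L) (S : Finset L) : ℤ := (-1) ^ (S.filter (· < s)).card

lemma incidenceSign_mul_self (s : L) (S : Finset L) :
    incidenceSign s S * incidenceSign s S = 1 := by
  rw [incidenceSign, ← mul_pow]; norm_num

lemma incidenceSign_insert {r : L} {T : Finset L} (s : L) (hr : r ∉ T) :
    incidenceSign s (insert r T) = (if r < s then -1 else 1) * incidenceSign s T := by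
  unfold incidenceSign
  rw [Finset.filter_insert]
  split_ifs with h
  · rw [Finset.card_insert_of_notMem (by simp [hr]), pow_succ, mul_comm]
  · simp

lemma incidenceSign_insert_self {s : L} {T : Finset L} (hs : s ∉ T) :
    incidenceSign s (insert s T) = incidenceSign s T := by
  simp [incidenceSign_insert s hs]

/-- The squares of the face lattice of a simplex anticommute. -/
lemma incidenceSign_anticomm {r s : L} {T : Finset L} (hrs : r ≠ s) (hr : r ∉ T) (hs : s ∉ T) :
    incidenceSign r (insert s T) * incidenceSign s (insert r T) =
      -(incidenceSign r T * incidenceSign s T) := by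
  rw [incidenceSign_insert r hs, incidenceSign_insert s hr]
  rcases lt_or_gt_of_ne hrs with h | h <;> simp [h, h.not_gt]

/-- Variant of the anticommutation rule, in the form in which it cancels terms of `∂ ∘ ∂`. -/
lemma incidenceSign_mul_insert {r s : L} {T : Finset L} (hrs : r ≠ s) (hr : r ∉ T) (hs : s ∉ T) :
    incidenceSign r T * incidenceSign s (insert r T) =
      -(incidenceSign s T * incidenceSign r (insert s T)) := by
  rw [incidenceSign_insert r hs, incidenceSign_insert s hr]
  rcases lt_or_gt_of_ne hrs with h | h <;> simp [h, h.not_gt] <;> ring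

variable [Fintype L] {A : Type*} [AddCommGroup A]

/-- The boundary map of the augmented simplex on the vertex set `L`, with coefficients in `A`. A
chain is a function on all faces, of all dimensions at once and including the empty face. -/
def simplexBoundary (f : Finset L → A) (T : Finset L) : A :=
  ∑ r ∈ Tᶜ, incidenceSign r T • f (insert r T)

lemma simplexBoundary_comp (f : Finset L → A) :
    simplexBoundary (simplexBoundary f) = 0 := by
  funext T
  simp only [simplexBoundary, Finset.smul_sum, smul_smul, Pi.zero_apply]
  rw [Finset.sum_sigma']
  refine Finset.sum_involution (fun x _ => ⟨x.2, x.1⟩) ?_ ?_ ?_ ?_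
  · rintro ⟨r, s⟩ h
    simp only [Finset.mem_sigma, Finset.mem_compl, Finset.mem_insert, not_or] at h
    obtain ⟨hr, hsr, hs⟩ := h
    simp only [Finset.insert_comm s r]
    rw [incidenceSign_mul_insert (Ne.symm hsr) hr hs, neg_smul, neg_add_cancel]
  · rintro ⟨r, s⟩ h _ heq
    simp only [Finset.mem_sigma, Finset.mem_compl, Finset.mem_insert, not_or] at h
    simp only [Sigma.mk.injEq, heq_eq_eq] at heq
    exact h.2.1 heq.1
  · rintro ⟨r, s⟩ h
    simp only [Finset.mem_sigma, Finset.mem_compl, Finset.mem_insert, not_or] at h ⊢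
    exact ⟨h.2.2, Ne.symm h.2.1, h.1⟩
  · rintro ⟨r, s⟩ _
    rfl

/-- The cone construction on chains, with apex `s`. -/
def simplexCone (s : L) (f : Finset L → A) (S : Finset L) : A :=
  if s ∈ S then incidenceSign s S • f (S.erase s) else 0

/-- Coning a cycle off gives a chain bounding it: the augmented simplex is acyclic. -/
lemma simplexBoundary_cone (s : L) {f : Finset L → A} (hf : simplexBoundary f = 0) :
    simplexBoundary (simplexCone s f) = f := by
  funext T
  by_cases hs : s ∈ T
  · obtain ⟨T', hsT', rfl⟩ : ∃ T', s ∉ T' ∧ T = insert s T' :=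
      ⟨T.erase s, Finset.notMem_erase s T, (Finset.insert_erase hs).symm⟩
    have hc : T'ᶜ = insert s (insert s T')ᶜ := by
      ext x; by_cases hx : x = s <;> simp [hx, hsT']
    have h := congrFun hf T'
    simp only [simplexBoundary, Pi.zero_apply] at h
    rw [hc, Finset.sum_insert (by simp)] at h
    have key : simplexBoundary (simplexCone s f) (insert s T') =
        -(incidenceSign s T' • ∑ r ∈ (insert s T')ᶜ, incidenceSign r T' • f (insert r T')) := by
      rw [simplexBoundary, Finset.smul_sum, ← Finset.sum_neg_distrib]
      refine Finset.sum_congr rfl fun r hr => ?_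
      simp only [Finset.mem_compl, Finset.mem_insert, not_or] at hr
      have hsr : s ∉ insert r T' := by simp [hsT', Ne.symm hr.1]
      rw [simplexCone, if_pos (by simp), Finset.insert_comm r s, Finset.erase_insert hsr,
        incidenceSign_insert_self hsr, smul_smul, smul_smul, ← neg_smul,
        incidenceSign_anticomm hr.1 hr.2 hsT', mul_comm (incidenceSign s T')]
    rw [key, ← smul_neg, ← eq_neg_of_add_eq_zero_left h, smul_smul, incidenceSign_mul_self,
      one_smul]
  · rw [simplexBoundary, Finset.sum_eq_single s]
    · rw [simplexCone, if_pos (by simp), Finset.erase_insert hs, incidenceSign_insert_self hs,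
        smul_smul, incidenceSign_mul_self, one_smul]
    · intro r _ hrs
      rw [simplexCone, if_neg (by simp [hs, Ne.symm hrs]), smul_zero]
    · simp [hs]

end Simplex

/-! ### Truncating polynomials to a set of monomials -/

section Filter

variable {σ k : Type*} [Field k]

open Classical in
/-- The sum of those terms of a polynomial whose exponent vector satisfies `P`. -/
noncomputable def monomialFilter (P : (σ →₀ ℕ) → Prop) :
    MvPolynomial σ k →ₗ[k] MvPolynomial σ k :=
  (MvPolynomial.basisMonomials σ k).constr k
    fun v => if P v then MvPolynomial.monomial v 1 else 0

open Classical in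
lemma coeff_monomialFilter (P : (σ →₀ ℕ) → Prop) (p : MvPolynomial σ k) (v : σ →₀ ℕ) :
    (monomialFilter P p).coeff v = if P v then p.coeff v else 0 := by
  induction p using MvPolynomial.induction_on' with
  | monomial u c =>
    have : (MvPolynomial.monomial u c : MvPolynomial σ k) =
        c • MvPolynomial.basisMonomials σ k u := by
      simp [MvPolynomial.smul_monomial]
    rw [this, map_smul, monomialFilter, Module.Basis.constr_basis]
    by_cases h : u = v
    · subst h; split_ifs <;> simp
    · split_ifs <;> simp [MvPolynomial.coeff_monomial, h]
  | add p q hp hq =>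
    rw [map_add, MvPolynomial.coeff_add, MvPolynomial.coeff_add, hp, hq]
    split_ifs <;> simp

lemma mem_support_monomialFilter {P : (σ →₀ ℕ) → Prop} {p : MvPolynomial σ k} {v : σ →₀ ℕ} :
    v ∈ (monomialFilter P p).support ↔ P v ∧ v ∈ p.support := by
  classical
  simp [MvPolynomial.mem_support_iff, coeff_monomialFilter]

end Filter

/-! ### The Taylor complex of a monomial ideal -/

section Taylor

open MvPolynomial

variable {σ k L : Type*} [Field k] [LinearOrder L] [Fintype L] (a : L → σ →₀ ℕ)

/-- The differential of the Taylor complex on the monomials with exponents `a s`, in all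
homological degrees at once. The basis element of the face `S` sits in the multidegree
`S.sup a`, which is the exponent of the least common multiple of the monomials in `S`. -/
noncomputable def taylorMap : (Finset L → MvPolynomial σ k) →ₗ[MvPolynomial σ k]
    (Finset L → MvPolynomial σ k) where
  toFun f T := ∑ r ∈ Tᶜ,
    incidenceSign r T • (monomial ((insert r T).sup a - T.sup a) (1 : k) * f (insert r T))
  map_add' f g := by
    funext T
    simp only [Pi.add_apply, mul_add, smul_add, Finset.sum_add_distrib]
  map_smul' c f := by
    funext T
    simp only [Pi.smul_apply, smul_eq_mul, RingHom.id_apply, Finset.mul_sum]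
    refine Finset.sum_congr rfl fun r _ => ?_
    rw [mul_smul_comm, mul_left_comm]

lemma taylorMap_apply (f : Finset L → MvPolynomial σ k) (T : Finset L) :
    taylorMap a f T = ∑ r ∈ Tᶜ,
      incidenceSign r T • (monomial ((insert r T).sup a - T.sup a) (1 : k) * f (insert r T)) :=
  rfl

/-- Multiplying the basis element of `S` by the least common multiple of `S` turns the Taylor
differential into the boundary map of the simplex. -/
lemma monomial_mul_taylorMap (f : Finset L → MvPolynomial σ k) (T : Finset L) :
    monomial (T.sup a) (1 : k) * taylorMap a f T =
      simplexBoundary (fun S => monomial (S.sup a) (1 : k) * f S) T := by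
  rw [taylorMap_apply, simplexBoundary, Finset.mul_sum]
  refine Finset.sum_congr rfl fun r _ => ?_
  rw [mul_smul_comm, ← mul_assoc, monomial_mul, one_mul,
    add_tsub_cancel_of_le (Finset.sup_mono (Finset.subset_insert r T))]

lemma taylorMap_comp (f : Finset L → MvPolynomial σ k) : taylorMap a (taylorMap a f) = 0 := by
  funext T
  have h : monomial (T.sup a) (1 : k) * taylorMap a (taylorMap a f) T = 0 := by
    rw [monomial_mul_taylorMap]
    simp_rw [monomial_mul_taylorMap]
    exact congrFun (simplexBoundary_comp _) T
  exact (mul_eq_zero.mp h).resolve_left (by simp [monomial_eq_zero])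

/-- A polynomial all of whose terms are divisible by a monomial is divisible by it. -/
lemma exists_eq_monomial_mul {u : σ →₀ ℕ} {p : MvPolynomial σ k}
    (h : ∀ v ∈ p.support, u ≤ v) : ∃ q, p = monomial u (1 : k) * q := by
  have : monomial u (1 : k) ∣ p := by
    rw [p.as_sum]
    refine Finset.dvd_sum fun v hv => ?_
    refine ⟨monomial (v - u) (coeff v p), ?_⟩
    rw [monomial_mul, one_mul, add_tsub_cancel_of_le (h v hv)]
  exact this

/-- Acyclicity of the Taylor complex. In the strand of multidegree `v` the faces are the sets of
generators dividing the monomial `v`, so the strand is a full simplex and every cycle in it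
is coned off from a generator dividing `v`; the hypothesis `h₀` provides such a generator also
for the empty face. -/
lemma exists_taylorMap_eq {f : Finset L → MvPolynomial σ k} (hf : taylorMap a f = 0)
    (h₀ : ∀ v ∈ (f ∅).support, ∃ s, a s ≤ v) : ∃ g, taylorMap a g = f := by
  classical
  rcases isEmpty_or_nonempty L with hL | hL
  · refine ⟨0, ?_⟩
    rw [map_zero]
    funext S
    rw [Finset.eq_empty_of_isEmpty S, Pi.zero_apply, eq_comm, ← support_eq_empty,
      Finset.eq_empty_iff_forall_notMem]
    exact fun v hv => hL.false (h₀ v hv).choose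
  -- an apex for each multidegree: a generator dividing it, if there is one
  obtain ⟨c, hc⟩ : ∃ c : (σ →₀ ℕ) → L, ∀ v, (∃ s, a s ≤ v) → a (c v) ≤ v := by
    refine ⟨fun v => if h : ∃ s, a s ≤ v then h.choose else Classical.arbitrary L, fun v h => ?_⟩
    simp only [dif_pos h]
    exact h.choose_spec
  set F : Finset L → MvPolynomial σ k := fun S => monomial (S.sup a) (1 : k) * f S with hF
  have hFsupp : ∀ S, ∀ v ∈ (F S).support, (∀ s ∈ S, a s ≤ v) ∧ a (c v) ≤ v := by
    intro S v hv
    have hle : S.sup a ≤ v := by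
      by_contra hcon
      rw [mem_support_iff, hF] at hv
      exact hv (by rw [coeff_monomial_mul', if_neg hcon])
    have hle' := Finset.sup_le_iff.mp hle
    refine ⟨hle', hc v ?_⟩
    rcases S.eq_empty_or_nonempty with rfl | ⟨s, hs⟩
    · refine h₀ v ?_
      have hbot : (⊥ : σ →₀ ℕ) = 0 := rfl
      simpa [hF, hbot] using hv
    · exact ⟨s, hle' s hs⟩
  have hFcycle : simplexBoundary F = 0 := by
    funext T
    rw [hF, ← monomial_mul_taylorMap, hf]
    simp
  let π : L → MvPolynomial σ k →ₗ[k] MvPolynomial σ k := fun s => monomialFilter fun v => c v = s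
  have hπcycle : ∀ s, simplexBoundary (fun S => π s (F S)) = 0 := by
    intro s
    funext T
    have := congrArg (π s) (congrFun hFcycle T)
    simpa only [simplexBoundary, map_sum, map_zsmul, Pi.zero_apply, map_zero] using this
  have hπsum : ∀ p, ∑ s, π s p = p := by
    intro p
    ext v
    rw [coeff_sum, Finset.sum_eq_single (c v)]
    · simp [π, coeff_monomialFilter]
    · intro s _ hs
      simp [π, coeff_monomialFilter, hs.symm]
    · simp
  let G : Finset L → MvPolynomial σ k := fun S => ∑ s, simplexCone s (fun S => π s (F S)) S
  have hG : simplexBoundary G = F := by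
    funext T
    have h1 : simplexBoundary G T =
        ∑ s, simplexBoundary (simplexCone s fun S => π s (F S)) T := by
      simp only [simplexBoundary, G, Finset.smul_sum]
      exact Finset.sum_comm
    rw [h1]
    simp_rw [simplexBoundary_cone _ (hπcycle _)]
    exact hπsum _
  have hGsupp : ∀ S, ∀ v ∈ (G S).support, S.sup a ≤ v := by
    intro S v hv
    rw [mem_support_iff, coeff_sum] at hv
    obtain ⟨s, -, hs⟩ := Finset.exists_ne_zero_of_sum_ne_zero hv
    rw [simplexCone] at hs
    split_ifs at hs with hsS
    swap
    · simp at hs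
    have hv' : v ∈ (π s (F (S.erase s))).support := by
      rw [mem_support_iff]
      intro h0
      apply hs
      rw [← lcoeff_apply, map_zsmul, lcoeff_apply, h0, smul_zero]
    obtain ⟨hcv, hvF⟩ := mem_support_monomialFilter.mp hv'
    obtain ⟨h1, h2⟩ := hFsupp _ v hvF
    refine Finset.sup_le fun r hr => ?_
    by_cases hrs : r = s
    · rw [hrs, ← hcv]; exact h2
    · exact h1 r (Finset.mem_erase.mpr ⟨hrs, hr⟩)
  choose g hg using fun S => exists_eq_monomial_mul (hGsupp S)
  refine ⟨g, ?_⟩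
  funext T
  have h1 : monomial (T.sup a) (1 : k) * taylorMap a g T = monomial (T.sup a) (1 : k) * f T := by
    rw [monomial_mul_taylorMap]
    simp_rw [← hg]
    exact congrFun hG T
  exact mul_left_cancel₀ (by simp [monomial_eq_zero]) h1

end Taylor

/-! ### The Taylor resolution -/

section TaylorResolution

open MvPolynomial

variable {σ k L : Type*} [Field k] (a : L → σ →₀ ℕ)

/-- The ideal generated by the monomials with exponents `a s`. -/
noncomputable def monomialIdeal (k : Type*) [Field k] (a : L → σ →₀ ℕ) :
    Ideal (MvPolynomial σ k) :=
  Ideal.span ((fun v => monomial v (1 : k)) '' Set.range a)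

lemma mem_monomialIdeal {p : MvPolynomial σ k} :
    p ∈ monomialIdeal k a ↔ ∀ v ∈ p.support, ∃ s, a s ≤ v := by
  rw [monomialIdeal, mem_ideal_span_monomial_image]
  simp

/-- The faces with `i` elements, which index the basis of the Taylor resolution in homological
degree `i`. -/
abbrev Face (L : Type*) (i : ℕ) : Type _ := {S : Finset L // S.card = i}

lemma extend_face_apply {A : Type*} [Zero A] {i : ℕ} (f : Face L i → A) {S : Finset L}
    (hS : S.card = i) : Function.extend Subtype.val f 0 S = f ⟨S, hS⟩ :=
  Subtype.val_injective.extend_apply f 0 (⟨S, hS⟩ : Face L i)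

lemma extend_face_apply_of_ne {A : Type*} [Zero A] {i : ℕ} (f : Face L i → A) {S : Finset L}
    (hS : S.card ≠ i) : Function.extend Subtype.val f 0 S = 0 := by
  rw [Function.extend_apply', Pi.zero_apply]
  rintro ⟨⟨T, hT⟩, rfl⟩
  exact hS hT

/-- The augmentation of the Taylor resolution. -/
noncomputable def taylorAug :
    (Face L 0 → MvPolynomial σ k) →ₗ[MvPolynomial σ k] (MvPolynomial σ k ⧸ monomialIdeal k a) :=
  Submodule.mkQ (monomialIdeal k a) ∘ₗ LinearMap.proj (⟨∅, rfl⟩ : Face L 0)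

lemma taylorAug_apply (f : Face L 0 → MvPolynomial σ k) :
    taylorAug a f = Ideal.Quotient.mk (monomialIdeal k a) (f ⟨∅, rfl⟩) := rfl

variable [LinearOrder L] [Fintype L]

/-- The Taylor differential from homological degree `i + 1` to homological degree `i`: chains
supported in one homological degree are extended by zero to all faces. -/
noncomputable def taylorDifferential (i : ℕ) :
    (Face L (i + 1) → MvPolynomial σ k) →ₗ[MvPolynomial σ k] (Face L i → MvPolynomial σ k) :=
  LinearMap.funLeft _ _ Subtype.val ∘ₗ taylorMap a ∘ₗ
    Function.ExtendByZero.linearMap _ Subtype.val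

lemma taylorDifferential_apply (i : ℕ) (f : Face L (i + 1) → MvPolynomial σ k) (T : Face L i) :
    taylorDifferential a i f T = taylorMap a (Function.extend Subtype.val f 0) T := rfl

lemma extend_taylorDifferential (i : ℕ) (f : Face L (i + 1) → MvPolynomial σ k) :
    Function.extend Subtype.val (taylorDifferential a i f) 0 =
      taylorMap a (Function.extend Subtype.val f 0) := by
  funext T
  by_cases hT : T.card = i
  · rw [extend_face_apply _ hT, taylorDifferential_apply]
  · rw [extend_face_apply_of_ne _ hT, taylorMap_apply, eq_comm]
    refine Finset.sum_eq_zero fun r hr => ?_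
    rw [extend_face_apply_of_ne, mul_zero, smul_zero]
    rw [Finset.card_insert_of_notMem (Finset.mem_compl.mp hr)]
    omega

/-- The Taylor map lowers the homological degree by exactly one, so only the part of a chain in
degree `i + 1` matters for the part of its image in degree `i`. -/
lemma taylorDifferential_restrict (i : ℕ) (g : Finset L → MvPolynomial σ k) (T : Face L i) :
    taylorDifferential a i (fun S => g S) T = taylorMap a g T := by
  rw [taylorDifferential_apply, taylorMap_apply, taylorMap_apply]
  refine Finset.sum_congr rfl fun r hr => ?_
  rw [extend_face_apply]
  rw [Finset.card_insert_of_notMem (Finset.mem_compl.mp hr), T.2]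

lemma taylorDifferential_exact (i : ℕ) :
    Function.Exact (taylorDifferential (k := k) a (i + 1)) (taylorDifferential a i) := by
  intro f
  constructor
  · intro hf
    have h : taylorMap a (Function.extend Subtype.val f 0) = 0 := by
      rw [← extend_taylorDifferential, hf]
      funext S
      by_cases hS : S.card = i
      · rw [extend_face_apply _ hS]; rfl
      · rw [extend_face_apply_of_ne _ hS]; rfl
    obtain ⟨g, hg⟩ := exists_taylorMap_eq a h (by
      rw [extend_face_apply_of_ne _ (by simp)]
      simp)
    refine ⟨fun S => g S, ?_⟩
    funext T
    rw [taylorDifferential_restrict, hg, extend_face_apply _ T.2]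
  · rintro ⟨g, rfl⟩
    funext T
    rw [taylorDifferential_apply, extend_taylorDifferential, taylorMap_comp]
    rfl

lemma taylorAug_exact : Function.Exact (taylorDifferential (k := k) a 0) (taylorAug a) := by
  intro f
  rw [taylorAug_apply, Ideal.Quotient.eq_zero_iff_mem]
  constructor
  · intro hf
    have h : taylorMap a (Function.extend Subtype.val f 0) = 0 := by
      funext T
      rw [taylorMap_apply, Pi.zero_apply]
      refine Finset.sum_eq_zero fun r hr => ?_
      rw [extend_face_apply_of_ne _ (by simp), mul_zero, smul_zero]
    obtain ⟨g, hg⟩ := exists_taylorMap_eq a h (by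
      rw [extend_face_apply f Finset.card_empty]
      exact (mem_monomialIdeal a).mp hf)
    refine ⟨fun S => g S, ?_⟩
    funext T
    rw [taylorDifferential_restrict, hg, extend_face_apply _ T.2]
  · rintro ⟨g, rfl⟩
    rw [taylorDifferential_apply, taylorMap_apply]
    refine Ideal.sum_mem _ fun r _ => zsmul_mem (Ideal.mul_mem_right _ _ ?_) _
    refine Ideal.subset_span ⟨a r, ⟨r, rfl⟩, ?_⟩
    have hbot : (⊥ : σ →₀ ℕ) = 0 := rfl
    simp [hbot]

open Classical in
lemma taylorDifferential_single (i : ℕ) (S : Face L (i + 1)) (T : Face L i) :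
    taylorDifferential (k := k) a i (Pi.single S 1) T = 0 ∨
      ∃ r ∉ T.1, S.1 = insert r T.1 ∧ taylorDifferential (k := k) a i (Pi.single S 1) T =
        incidenceSign r T.1 • monomial (S.1.sup a - T.1.sup a) 1 := by
  have hext : ∀ r ∉ T.1, Function.extend Subtype.val (Pi.single S (1 : MvPolynomial σ k)) 0
      (insert r T.1) = if S.1 = insert r T.1 then 1 else 0 := by
    intro r hr
    rw [extend_face_apply _ (by rw [Finset.card_insert_of_notMem hr, T.2]), Pi.single_apply]
    simp only [Subtype.ext_iff, eq_comm]
  by_cases h : ∃ r ∉ T.1, S.1 = insert r T.1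
  · obtain ⟨r, hr, hS⟩ := h
    refine Or.inr ⟨r, hr, hS, ?_⟩
    rw [taylorDifferential_apply, taylorMap_apply, Finset.sum_eq_single r]
    · rw [hext r hr, if_pos hS, mul_one, hS]
    · intro s hs hsr
      have hs' := Finset.mem_compl.mp hs
      rw [hext s hs', if_neg, mul_zero, smul_zero]
      intro h
      have : s ∈ insert r T.1 := by rw [← hS, h]; simp
      simp [hsr, hs'] at this
    · simp [hr]
  · left
    rw [taylorDifferential_apply, taylorMap_apply]
    refine Finset.sum_eq_zero fun r hr => ?_
    have hr' := Finset.mem_compl.mp hr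
    rw [hext r hr', if_neg fun h' => h ⟨r, hr', h'⟩, mul_zero, smul_zero]

open Classical in
lemma isHomogeneous_taylorDifferential_single (i : ℕ) (S : Face L (i + 1)) (T : Face L i) :
    IsHomogeneousOfDegree (taylorDifferential (k := k) a i (Pi.single S 1) T)
      ((S.1.sup a).degree - (T.1.sup a).degree : ℤ) := by
  rcases taylorDifferential_single (k := k) a i S T with h | ⟨r, -, hS, h⟩
  · intro e he
    simp [h] at he
  · have hle : T.1.sup a ≤ S.1.sup a := by
      rw [hS]; exact Finset.sup_mono (Finset.subset_insert r T.1)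
    intro e he
    rw [h, mem_support_iff] at he
    have he' : e = S.1.sup a - T.1.sup a := by
      by_contra hne
      apply he
      rw [← lcoeff_apply, map_zsmul, lcoeff_apply, coeff_monomial, if_neg (Ne.symm hne), smul_zero]
    have := congrArg Finsupp.degree (tsub_add_cancel_of_le hle)
    rw [map_add] at this
    rw [he', ← this]
    push_cast
    ring

open Classical in
/-- If no generator divides the least common multiple of others, the entries of the Taylor
differentials have no constant term. -/
lemma taylorDifferential_single_mem (ha : ∀ (S : Finset L) (r : L), r ∉ S → ¬ a r ≤ S.sup a)
    (i : ℕ) (S : Face L (i + 1)) (T : Face L i) :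
    taylorDifferential (k := k) a i (Pi.single S 1) T ∈
      Ideal.span (Set.range (X : σ → MvPolynomial σ k)) := by
  rcases taylorDifferential_single (k := k) a i S T with h | ⟨r, hr, hS, h⟩
  · rw [h]; exact zero_mem _
  · rw [h]
    refine zsmul_mem ?_ _
    rw [← Set.image_univ, mem_ideal_span_X_image]
    intro m hm
    have hm' : m = S.1.sup a - T.1.sup a := by
      by_contra hne
      rw [mem_support_iff, coeff_monomial, if_neg (Ne.symm hne)] at hm
      exact hm rfl
    by_contra! hcon
    have h0 : m = 0 := by ext x; exact hcon x trivial
    rw [hm', tsub_eq_zero_iff_le, hS] at h0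
    exact ha T.1 r hr ((Finset.le_sup (f := a) (Finset.mem_insert_self r T.1)).trans h0)

lemma mem_smul_top_of_forall {ι : Type*} [Finite ι] {R : Type*} [CommRing R] {J : Ideal R}
    {f : ι → R} (h : ∀ b, f b ∈ J) : f ∈ J • (⊤ : Submodule R (ι → R)) := by
  classical
  cases nonempty_fintype ι
  rw [pi_eq_sum_univ' f]
  exact Submodule.sum_mem _ fun b _ => Submodule.smul_mem_smul (h b) trivial

lemma mem_of_mem_smul_top {ι : Type*} {R : Type*} [CommRing R] {J : Ideal R}
    {f : ι → R} (h : f ∈ J • (⊤ : Submodule R (ι → R))) (b : ι) : f b ∈ J := by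
  induction h using Submodule.smul_induction_on' with
  | smul r hr g _ => exact Ideal.mul_mem_right _ _ hr
  | add x _ y _ hx hy => exact add_mem hx hy

/-- A linear map out of a finite free module takes values in any ideal containing its matrix
entries. -/
lemma apply_mem_of_forall_single {ι ι' R : Type*} [Fintype ι] [DecidableEq ι] [CommRing R]
    {J : Ideal R} (φ : (ι → R) →ₗ[R] (ι' → R)) {b : ι'} (h : ∀ c, φ (Pi.single c 1) b ∈ J)
    (f : ι → R) : φ f b ∈ J := by
  rw [LinearMap.pi_apply_eq_sum_univ φ f, Finset.sum_apply]
  refine Ideal.sum_mem _ fun c _ => Ideal.mul_mem_left _ _ ?_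
  have hc : (fun j => if c = j then (1 : R) else 0) = Pi.single c 1 := by
    funext x
    simp [Pi.single_apply, eq_comm]
  rw [hc]
  exact h c

/-- A numbering of the faces with `i` elements. -/
noncomputable def faceEquiv (L : Type*) [Fintype L] (i : ℕ) :
    Face L i ≃ Fin (Fintype.card (Face L i)) :=
  Fintype.equivFin _

/-- Functions on the numbers of the faces with `i` elements, as functions on these faces. -/
noncomputable def faceReindex (R L : Type*) [CommRing R] [Fintype L] (i : ℕ) :
    (Fin (Fintype.card (Face L i)) → R) ≃ₗ[R] (Face L i → R) :=
  LinearEquiv.funCongrLeft R R (faceEquiv L i)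

lemma faceReindex_single {R L : Type*} [CommRing R] [Fintype L] [DecidableEq L] {i : ℕ}
    (c : Fin (Fintype.card (Face L i))) :
    faceReindex R L i (Pi.single c 1) = Pi.single ((faceEquiv L i).symm c) 1 := by
  funext x
  simp [faceReindex, LinearMap.funLeft_apply, Pi.single_apply, Equiv.eq_symm_apply]

lemma faceReindex_symm_apply {R L : Type*} [CommRing R] [Fintype L] {i : ℕ} (f : Face L i → R)
    (c : Fin (Fintype.card (Face L i))) :
    (faceReindex R L i).symm f c = f ((faceEquiv L i).symm c) := rfl

lemma mem_range_faceReindex {R L : Type*} [CommRing R] [Fintype L] {i j : ℕ}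
    (φ : (Face L i → R) →ₗ[R] (Face L j → R)) (f : Fin (Fintype.card (Face L j)) → R) :
    faceReindex R L j f ∈ Set.range φ ↔ f ∈ Set.range
      ((faceReindex R L j).symm.toLinearMap ∘ₗ φ ∘ₗ (faceReindex R L i).toLinearMap) := by
  constructor
  · rintro ⟨g, hg⟩
    exact ⟨(faceReindex R L i).symm g, by simp [hg]⟩
  · rintro ⟨g, rfl⟩
    exact ⟨faceReindex R L i g, by simp⟩

/-- The Taylor resolution of a monomial ideal none of whose generators divides the least common
multiple of others: under this hypothesis it is minimal. -/
noncomputable def taylorResolution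
    (ha : ∀ (S : Finset L) (r : L), r ∉ S → ¬ a r ≤ S.sup a) :
    MinimalGradedFreeResolution (monomialIdeal k a) where
  rank i := Fintype.card (Face L i)
  deg i c := (((faceEquiv L i).symm c).1.sup a).degree
  d i := (faceReindex _ L i).symm.toLinearMap ∘ₗ taylorDifferential a i ∘ₗ
    (faceReindex _ L (i + 1)).toLinearMap
  aug := taylorAug a ∘ₗ (faceReindex _ L 0).toLinearMap
  aug_homogeneous c := by
    classical
    refine ⟨1, ?_, ?_⟩
    · intro e he
      have he0 : e = 0 := by
        by_contra hne
        rw [mem_support_iff, coeff_one, if_neg (Ne.symm hne)] at he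
        exact he rfl
      have hc : ((faceEquiv L 0).symm c).1 = ∅ := Finset.card_eq_zero.mp ((faceEquiv L 0).symm c).2
      have hbot : (⊥ : σ →₀ ℕ) = 0 := rfl
      rw [hc, he0, Finset.sup_empty, hbot]
    · rw [LinearMap.comp_apply, LinearEquiv.coe_coe, faceReindex_single, taylorAug_apply,
        Pi.single_apply, if_pos]
      exact Subtype.ext (Finset.card_eq_zero.mp ((faceEquiv L 0).symm c).2).symm
  d_homogeneous i c b := by
    classical
    rw [LinearMap.comp_apply, LinearMap.comp_apply, LinearEquiv.coe_coe, LinearEquiv.coe_coe,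
      faceReindex_symm_apply, faceReindex_single]
    exact isHomogeneous_taylorDifferential_single a i _ _
  aug_surjective := by
    rw [LinearMap.coe_comp]
    refine Function.Surjective.comp (fun x => ?_) (LinearEquiv.surjective _)
    obtain ⟨p, rfl⟩ := Ideal.Quotient.mk_surjective x
    exact ⟨fun _ => p, rfl⟩
  exact_aug := by
    intro f
    have h := taylorAug_exact (k := k) a (faceReindex _ L 0 f)
    rw [LinearMap.comp_apply, LinearEquiv.coe_coe, h, mem_range_faceReindex]
  exact_d i := by
    intro f
    have h := taylorDifferential_exact (k := k) a i (faceReindex _ L (i + 1) f)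
    rw [LinearMap.comp_apply, LinearMap.comp_apply, LinearEquiv.coe_coe, LinearEquiv.coe_coe,
      LinearEquiv.map_eq_zero_iff, h, mem_range_faceReindex]
  minimal i := by
    classical
    rintro _ ⟨f, rfl⟩
    refine mem_smul_top_of_forall fun b => ?_
    exact apply_mem_of_forall_single (taylorDifferential a i)
      (fun c => taylorDifferential_single_mem a ha i c _) _

end TaylorResolution

/-! ### Uniqueness of the graded Betti numbers -/

section Homogeneous

open MvPolynomial

variable {σ k : Type*} [Field k]

lemma isHomogeneousOfDegree_zero (n : ℤ) : IsHomogeneousOfDegree (0 : MvPolynomial σ k) n := by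
  intro e he
  simp at he

lemma IsHomogeneousOfDegree.add {p q : MvPolynomial σ k} {n : ℤ}
    (hp : IsHomogeneousOfDegree p n) (hq : IsHomogeneousOfDegree q n) :
    IsHomogeneousOfDegree (p + q) n := by
  classical
  intro e he
  rcases Finset.mem_union.mp (support_add he) with h | h
  exacts [hp e h, hq e h]

lemma IsHomogeneousOfDegree.mul {p q : MvPolynomial σ k} {m n : ℤ}
    (hp : IsHomogeneousOfDegree p m) (hq : IsHomogeneousOfDegree q n) :
    IsHomogeneousOfDegree (p * q) (m + n) := by
  classical
  intro e he
  obtain ⟨u, hu, v, hv, rfl⟩ := Finset.mem_add.mp (support_mul p q he)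
  rw [map_add, Nat.cast_add, hp u hu, hq v hv]

lemma isHomogeneousOfDegree_C (c : k) : IsHomogeneousOfDegree (C c : MvPolynomial σ k) 0 := by
  classical
  intro e he
  rw [mem_support_iff, coeff_C] at he
  have : (0 : σ →₀ ℕ) = e := by
    by_contra h
    exact he (if_neg h)
  simp [← this]

lemma isHomogeneousOfDegree_sum {ι : Type*} (s : Finset ι) {f : ι → MvPolynomial σ k} {n : ℤ}
    (h : ∀ i ∈ s, IsHomogeneousOfDegree (f i) n) : IsHomogeneousOfDegree (∑ i ∈ s, f i) n := by
  classical
  induction s using Finset.induction_on with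
  | empty => simpa using isHomogeneousOfDegree_zero n
  | insert i s hi ih =>
    rw [Finset.sum_insert hi]
    exact (h i (by simp)).add (ih fun j hj => h j (by simp [hj]))

lemma isHomogeneousOfDegree_prod {ι : Type*} (s : Finset ι) {f : ι → MvPolynomial σ k} {n : ι → ℤ}
    (h : ∀ i ∈ s, IsHomogeneousOfDegree (f i) (n i)) :
    IsHomogeneousOfDegree (∏ i ∈ s, f i) (∑ i ∈ s, n i) := by
  classical
  induction s using Finset.induction_on with
  | empty => simpa using isHomogeneousOfDegree_C (1 : k)
  | insert i s hi ih =>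
    rw [Finset.prod_insert hi, Finset.sum_insert hi]
    exact (h i (by simp)).mul (ih fun j hj => h j (by simp [hj]))

lemma IsHomogeneousOfDegree.eq_C {p : MvPolynomial σ k} (hp : IsHomogeneousOfDegree p 0) :
    p = C (constantCoeff p) := by
  classical
  ext e
  rw [coeff_C, constantCoeff_eq]
  split_ifs with h
  · rw [h]
  · by_contra hne
    have := hp e (mem_support_iff.mpr hne)
    exact h ((Finsupp.degree_eq_zero_iff e).mp (by exact_mod_cast this)).symm

lemma IsHomogeneousOfDegree.constantCoeff_eq_zero {p : MvPolynomial σ k} {n : ℤ}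
    (hp : IsHomogeneousOfDegree p n) (hn : n ≠ 0) : constantCoeff p = 0 := by
  by_contra h
  rw [constantCoeff_eq] at h
  have := hp 0 (mem_support_iff.mpr h)
  simp only [map_zero, Nat.cast_zero] at this
  exact hn this.symm

/-- The homogeneous component of integral degree `n` of a polynomial; it is zero for negative
`n`. -/
noncomputable def component (n : ℤ) : MvPolynomial σ k →ₗ[k] MvPolynomial σ k :=
  monomialFilter fun v => (v.degree : ℤ) = n

lemma isHomogeneous_component (n : ℤ) (p : MvPolynomial σ k) :
    IsHomogeneousOfDegree (component n p) n :=
  fun _ he => (mem_support_monomialFilter.mp he).1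

lemma IsHomogeneousOfDegree.component_eq {p : MvPolynomial σ k} {n : ℤ}
    (hp : IsHomogeneousOfDegree p n) : component n p = p := by
  classical
  ext v
  rw [component, coeff_monomialFilter]
  split_ifs with h
  · rfl
  · by_contra hne
    exact h (hp v (mem_support_iff.mpr (Ne.symm hne)))

lemma component_mul {p q : MvPolynomial σ k} {m n : ℤ} (hq : IsHomogeneousOfDegree q m) :
    component (n + m) (p * q) = component n p * q := by
  classical
  ext v
  rw [component, coeff_monomialFilter, coeff_mul, coeff_mul]
  have key : ∀ x ∈ Finset.HasAntidiagonal.antidiagonal v, coeff x.1 (component n p) * coeff x.2 q =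
      if (v.degree : ℤ) = n + m then coeff x.1 p * coeff x.2 q else 0 := by
    intro x hx
    by_cases h0 : coeff x.2 q = 0
    · simp [h0]
    have h2 := hq x.2 (mem_support_iff.mpr h0)
    have h3 : (v.degree : ℤ) = x.1.degree + m := by
      rw [← h2, ← Finset.HasAntidiagonal.mem_antidiagonal.mp hx, map_add, Nat.cast_add]
    rw [component, coeff_monomialFilter, h3]
    simp only [add_left_inj, ite_mul, zero_mul]
  rw [Finset.sum_congr rfl key]
  split_ifs <;> simp

/-- Uniqueness uses the grading through this fact: a square matrix of homogeneous polynomials,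
graded compatibly with degrees on the basis and equal to the identity modulo the variables, has
a determinant of degree zero, which is therefore the constant `1`. -/
lemma isUnit_of_constantCoeff_eq_one {m : ℕ} {deg : Fin m → ℤ}
    {U : Matrix (Fin m) (Fin m) (MvPolynomial σ k)}
    (hU : ∀ a b, IsHomogeneousOfDegree (U b a) (deg a - deg b))
    (h1 : U.map constantCoeff = 1) : IsUnit U := by
  rw [Matrix.isUnit_iff_isUnit_det]
  have hdet : IsHomogeneousOfDegree U.det 0 := by
    rw [Matrix.det_apply']
    refine isHomogeneousOfDegree_sum _ fun τ _ => ?_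
    have h2 : IsHomogeneousOfDegree (∏ i, U (τ i) i) 0 := by
      have h3 := isHomogeneousOfDegree_prod Finset.univ fun i _ => hU i (τ i)
      rwa [Finset.sum_sub_distrib, Equiv.sum_comp τ deg, sub_self] at h3
    have h4 := (isHomogeneousOfDegree_C (σ := σ) (((Equiv.Perm.sign τ : ℤˣ) : ℤ) : k)).mul h2
    simpa using h4
  have hc : constantCoeff U.det = 1 := by
    rw [RingHom.map_det, RingHom.mapMatrix_apply, h1, Matrix.det_one]
  rw [hdet.eq_C, hc, C_1]
  exact isUnit_one

end Homogeneous

section GradedMaps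

open MvPolynomial Matrix

variable {σ k : Type*} [Field k] {m n : ℕ} {degF : Fin m → ℤ} {degG : Fin n → ℤ}

/-- A linear map between graded free modules which preserves degrees. -/
def IsGradedMap (degF : Fin m → ℤ) (degG : Fin n → ℤ)
    (φ : (Fin m → MvPolynomial σ k) →ₗ[MvPolynomial σ k] (Fin n → MvPolynomial σ k)) : Prop :=
  ∀ a b, IsHomogeneousOfDegree (φ (Pi.single a 1) b) (degF a - degG b)

lemma apply_eq_sum_single {R M : Type*} [CommRing R] [AddCommGroup M] [Module R M]
    (φ : (Fin m → R) →ₗ[R] M) (y : Fin m → R) : φ y = ∑ c, y c • φ (Pi.single c 1) := by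
  rw [LinearMap.pi_apply_eq_sum_univ φ y]
  refine Finset.sum_congr rfl fun c _ => ?_
  congr 2
  funext x
  simp [Pi.single_apply, eq_comm]

/-- A homogeneous element in the image of a graded map has a homogeneous preimage. -/
lemma IsGradedMap.exists_homogeneous_preimage
    {φ : (Fin m → MvPolynomial σ k) →ₗ[MvPolynomial σ k] (Fin n → MvPolynomial σ k)}
    (hφ : IsGradedMap degF degG φ) {z : Fin n → MvPolynomial σ k} {D : ℤ}
    (hz : ∀ b, IsHomogeneousOfDegree (z b) (D - degG b)) (hmem : z ∈ Set.range φ) :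
    ∃ y, (∀ a, IsHomogeneousOfDegree (y a) (D - degF a)) ∧ φ y = z := by
  obtain ⟨y, rfl⟩ := hmem
  refine ⟨fun a => component (D - degF a) (y a), fun a => isHomogeneous_component _ _, ?_⟩
  funext b
  rw [← (hz b).component_eq, apply_eq_sum_single φ y, apply_eq_sum_single φ, Finset.sum_apply,
    Finset.sum_apply, map_sum]
  refine Finset.sum_congr rfl fun a _ => ?_
  rw [Pi.smul_apply, Pi.smul_apply, smul_eq_mul, smul_eq_mul, ← component_mul (hφ a b)]
  congr 2
  ring

/-- If the product of two matrices is the identity and the entries of one of them vanish outside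
the blocks given by degrees, then the blocks of any degree `j` also have product the identity. -/
lemma degree_block_mul_eq_one {A : Matrix (Fin m) (Fin n) k} {B : Matrix (Fin n) (Fin m) k}
    (hAB : A * B = 1) (hA : ∀ a b, degF a ≠ degG b → A a b = 0) (j : ℤ) :
    A.submatrix (Subtype.val : {a // degF a = j} → Fin m)
        (Subtype.val : {b // degG b = j} → Fin n) *
      B.submatrix (Subtype.val : {b // degG b = j} → Fin n)
        (Subtype.val : {a // degF a = j} → Fin m) = 1 := by
  ext ⟨a, ha⟩ ⟨a', ha'⟩
  have h := congrFun (congrFun hAB a) a'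
  rw [Matrix.mul_apply] at h ⊢
  simp only [Matrix.submatrix_apply, Matrix.one_apply, Subtype.mk.injEq] at h ⊢
  rw [← h, ← Finset.sum_subtype (Finset.univ.filter fun b => degG b = j) (by simp)
    (fun b => A a b * B b a'), Finset.sum_filter_of_ne]
  intro b _ hb
  by_contra hne
  exact hb (by rw [hA a b fun h => hne (h ▸ ha), zero_mul])

/-- Two mutually inverse matrices over a field whose entries vanish unless the degrees of row and
column agree have as many rows as columns of each degree. -/
lemma card_degree_eq {A : Matrix (Fin m) (Fin n) k} {B : Matrix (Fin n) (Fin m) k}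
    (hAB : A * B = 1) (hBA : B * A = 1) (hA : ∀ a b, degF a ≠ degG b → A a b = 0)
    (hB : ∀ b a, degG b ≠ degF a → B b a = 0) (j : ℤ) :
    Fintype.card {a // degF a = j} = Fintype.card {b // degG b = j} := by
  have := (Matrix.toLin'OfInv (degree_block_mul_eq_one hAB hA j)
    (degree_block_mul_eq_one hBA hB j)).finrank_eq
  simpa using this

/-- An endomorphism of a cover, over the covered module, is the identity modulo the variables if
the kernel of the cover is zero modulo the variables. -/
lemma map_constantCoeff_eq_one_of_lift {A : Type*} [AddCommGroup A] [Module (MvPolynomial σ k) A]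
    {p : (Fin m → MvPolynomial σ k) →ₗ[MvPolynomial σ k] A}
    (hp : ∀ y, p y = 0 → ∀ b, constantCoeff (y b) = 0)
    {U : Matrix (Fin m) (Fin m) (MvPolynomial σ k)} (hU : ∀ y, p (U.mulVec y) = p y) :
    U.map constantCoeff = 1 := by
  ext b a
  have h := hp (U.mulVec (Pi.single a 1) - Pi.single a 1) (by rw [map_sub, hU, sub_self]) b
  rw [Matrix.mulVec_single_one, Pi.sub_apply, map_sub, sub_eq_zero] at h
  rw [Matrix.map_apply, ← Matrix.col_apply U, h, Pi.single_apply, Matrix.one_apply]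
  split_ifs <;> simp

/-- Uniqueness of minimal graded covers. Two graded covers `p`, `q` of the same module with kernels
inside `𝔪` times the free module, where `𝔪` is generated by the variables, differ by a
degree-preserving isomorphism. The hypotheses `hpq` and `hqp` give homogeneous lifts of either
cover through the other; their composites are the identity modulo `𝔪`. -/
theorem exists_graded_equiv_of_minimal_covers {A : Type*} [AddCommGroup A]
    [Module (MvPolynomial σ k) A]
    (p : (Fin m → MvPolynomial σ k) →ₗ[MvPolynomial σ k] A)
    (q : (Fin n → MvPolynomial σ k) →ₗ[MvPolynomial σ k] A)
    (hp : ∀ y, p y = 0 → ∀ b, constantCoeff (y b) = 0)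
    (hq : ∀ y, q y = 0 → ∀ b, constantCoeff (y b) = 0)
    (hpq : ∀ a, ∃ y, (∀ b, IsHomogeneousOfDegree (y b) (degF a - degG b)) ∧
      q y = p (Pi.single a 1))
    (hqp : ∀ b, ∃ y, (∀ a, IsHomogeneousOfDegree (y a) (degG b - degF a)) ∧
      p y = q (Pi.single b 1)) :
    ∃ e : (Fin m → MvPolynomial σ k) ≃ₗ[MvPolynomial σ k] (Fin n → MvPolynomial σ k),
      IsGradedMap degF degG e.toLinearMap ∧ (∀ y, q (e y) = p y) ∧
      ∀ j, Fintype.card {a // degF a = j} = Fintype.card {b // degG b = j} := by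
  choose φ hφ hqφ using hpq
  choose ψ hψ hpψ using hqp
  let Φ : Matrix (Fin n) (Fin m) (MvPolynomial σ k) := fun b a => φ a b
  let Ψ : Matrix (Fin m) (Fin n) (MvPolynomial σ k) := fun a b => ψ b a
  have hΦ : ∀ y, q (Φ.mulVec y) = p y := by
    intro y
    rw [apply_eq_sum_single p y, ← Matrix.mulVecLin_apply, apply_eq_sum_single Φ.mulVecLin y,
      map_sum]
    refine Finset.sum_congr rfl fun a _ => ?_
    rw [map_smul, ← hqφ, Matrix.mulVecLin_apply, Matrix.mulVec_single_one]
    rfl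
  have hΨ : ∀ y, p (Ψ.mulVec y) = q y := by
    intro y
    rw [apply_eq_sum_single q y, ← Matrix.mulVecLin_apply, apply_eq_sum_single Ψ.mulVecLin y,
      map_sum]
    refine Finset.sum_congr rfl fun a _ => ?_
    rw [map_smul, ← hpψ, Matrix.mulVecLin_apply, Matrix.mulVec_single_one]
    rfl
  have h1 : (Ψ * Φ).map constantCoeff = 1 := map_constantCoeff_eq_one_of_lift hp fun y => by
    rw [← Matrix.mulVec_mulVec, hΨ, hΦ]
  have h2 : (Φ * Ψ).map constantCoeff = 1 := map_constantCoeff_eq_one_of_lift hq fun y => by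
    rw [← Matrix.mulVec_mulVec, hΦ, hΨ]
  have hu1 : IsUnit (Ψ * Φ) := isUnit_of_constantCoeff_eq_one (deg := degF) (fun a b => by
    rw [Matrix.mul_apply]
    refine isHomogeneousOfDegree_sum _ fun c _ => ?_
    have := (hψ c b).mul (hφ a c)
    rwa [sub_add_sub_comm, add_comm (degG c), add_sub_add_right_eq_sub] at this) h1
  have hu2 : IsUnit (Φ * Ψ) := isUnit_of_constantCoeff_eq_one (deg := degG) (fun a b => by
    rw [Matrix.mul_apply]
    refine isHomogeneousOfDegree_sum _ fun c _ => ?_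
    have := (hφ c b).mul (hψ a c)
    rwa [sub_add_sub_comm, add_comm (degF c), add_sub_add_right_eq_sub] at this) h2
  have hbij : Function.Bijective Φ.mulVecLin := by
    constructor
    · intro x y hxy
      have := Matrix.mulVec_injective_of_isUnit hu1
      apply this
      simp only [← Matrix.mulVec_mulVec]
      exact congrArg Ψ.mulVec hxy
    · intro y
      obtain ⟨W, hW⟩ := hu2
      refine ⟨Ψ.mulVec ((W⁻¹).1.mulVec y), ?_⟩
      rw [Matrix.mulVecLin_apply, Matrix.mulVec_mulVec, ← hW, Matrix.mulVec_mulVec, Units.mul_inv,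
        Matrix.one_mulVec]
  refine ⟨LinearEquiv.ofBijective Φ.mulVecLin hbij, fun a b => ?_, fun y => hΦ y, fun j => ?_⟩
  · have h : LinearEquiv.ofBijective Φ.mulVecLin hbij (Pi.single a 1) = φ a := by
      rw [LinearEquiv.ofBijective_apply, Matrix.mulVecLin_apply, Matrix.mulVec_single_one]
      rfl
    rw [LinearEquiv.coe_coe, h]
    exact hφ a b
  · refine card_degree_eq (k := k) (A := Ψ.map constantCoeff) (B := Φ.map constantCoeff)
      ?_ ?_ (fun a b h => ?_) (fun b a h => ?_) j
    · rw [← Matrix.map_mul, h1]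
    · rw [← Matrix.map_mul, h2]
    · exact (hψ b a).constantCoeff_eq_zero (sub_ne_zero.mpr h.symm)
    · exact (hφ a b).constantCoeff_eq_zero (sub_ne_zero.mpr h.symm)

end GradedMaps

section Betti

open MvPolynomial

variable {σ k : Type*} [Field k] {I : Ideal (MvPolynomial σ k)}

lemma constantCoeff_eq_zero_of_mem {p : MvPolynomial σ k}
    (hp : p ∈ Ideal.span (Set.range (X : σ → MvPolynomial σ k))) : constantCoeff p = 0 := by
  have : Ideal.span (Set.range (X : σ → MvPolynomial σ k)) ≤ RingHom.ker constantCoeff := by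
    rw [Ideal.span_le]
    rintro _ ⟨x, rfl⟩
    simp
  exact this hp

lemma MinimalGradedFreeResolution.constantCoeff_eq_zero (F : MinimalGradedFreeResolution I) {i : ℕ}
    {y : Fin (F.rank i) → MvPolynomial σ k} (hy : y ∈ Set.range (F.d i)) (b : Fin (F.rank i)) :
    constantCoeff (y b) = 0 :=
  constantCoeff_eq_zero_of_mem (mem_of_mem_smul_top (F.minimal i hy) b)

/-- Homogeneous elements of `R/I` lift to homogeneous elements of the zeroth free module. -/
lemma MinimalGradedFreeResolution.exists_homogeneous_preimage_aug
    (F : MinimalGradedFreeResolution I) (hI : ∀ p ∈ I, ∀ n, component n p ∈ I) {D : ℤ}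
    {z : MvPolynomial σ k ⧸ I} (hz : z ∈ quotientComponent I D) :
    ∃ y, (∀ a, IsHomogeneousOfDegree (y a) (D - F.deg 0 a)) ∧ F.aug y = z := by
  obtain ⟨P, hP, rfl⟩ := hz
  choose Q hQ hQaug using F.aug_homogeneous
  obtain ⟨y, hy⟩ := F.aug_surjective (Ideal.Quotient.mk I P)
  have haug : ∀ y, F.aug y = Ideal.Quotient.mk I (∑ a, y a * Q a) := by
    intro y
    rw [apply_eq_sum_single F.aug y, map_sum]
    refine Finset.sum_congr rfl fun a _ => ?_
    rw [map_mul, hQaug]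
    rfl
  refine ⟨fun a => component (D - F.deg 0 a) (y a), fun a => isHomogeneous_component _ _, ?_⟩
  rw [haug, Ideal.Quotient.eq] at hy ⊢
  have := hI _ hy D
  rw [map_sub, hP.component_eq, map_sum] at this
  convert this using 2
  refine Finset.sum_congr rfl fun a _ => ?_
  rw [← component_mul (hQ a)]
  congr 2
  ring

/-- Two minimal graded free resolutions are isomorphic, one homological degree at a time: the
isomorphism in degree `i` matches the modules of boundaries, so that the free modules in degree
`i + 1` are minimal covers of the same module. -/
theorem MinimalGradedFreeResolution.exists_graded_equiv (F G : MinimalGradedFreeResolution I)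
    (hI : ∀ p ∈ I, ∀ n, component n p ∈ I) (i : ℕ) :
    ∃ e : (Fin (F.rank i) → MvPolynomial σ k) ≃ₗ[MvPolynomial σ k]
        (Fin (G.rank i) → MvPolynomial σ k),
      IsGradedMap (F.deg i) (G.deg i) e.toLinearMap ∧
      (∀ y, y ∈ Set.range (F.d i) ↔ e y ∈ Set.range (G.d i)) ∧
      ∀ j, F.betti i j = G.betti i j := by
  induction i with
  | zero =>
    obtain ⟨e, he, hpq, hcard⟩ := exists_graded_equiv_of_minimal_covers F.aug G.aug
      (fun y hy => F.constantCoeff_eq_zero ((F.exact_aug y).mp hy))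
      (fun y hy => G.constantCoeff_eq_zero ((G.exact_aug y).mp hy))
      (fun a => G.exists_homogeneous_preimage_aug hI (F.aug_homogeneous a))
      (fun b => F.exists_homogeneous_preimage_aug hI (G.aug_homogeneous b))
    refine ⟨e, he, fun y => ?_, hcard⟩
    rw [← F.exact_aug, ← G.exact_aug, hpq]
  | succ i ih =>
    obtain ⟨e, he, hrange, -⟩ := ih
    have hgr : IsGradedMap (F.deg (i + 1)) (G.deg i) (e.toLinearMap ∘ₗ F.d i) := by
      intro a b
      rw [LinearMap.comp_apply, apply_eq_sum_single e.toLinearMap, Finset.sum_apply]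
      refine isHomogeneousOfDegree_sum _ fun c _ => ?_
      have := (F.d_homogeneous i a c).mul (he c b)
      rwa [sub_add_sub_cancel] at this
    obtain ⟨e', he', hpq, hcard⟩ := exists_graded_equiv_of_minimal_covers
      (e.toLinearMap ∘ₗ F.d i) (G.d i)
      (fun y hy => F.constantCoeff_eq_zero ((F.exact_d i y).mp (e.map_eq_zero_iff.mp hy)))
      (fun y hy => G.constantCoeff_eq_zero ((G.exact_d i y).mp hy))
      (fun a => IsGradedMap.exists_homogeneous_preimage (G.d_homogeneous i) (hgr a)
        ((hrange _).mp ⟨_, rfl⟩))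
      (fun b => hgr.exists_homogeneous_preimage (G.d_homogeneous i b) (by
        obtain ⟨x, hx⟩ := (hrange (e.symm (G.d i (Pi.single b 1)))).mpr
          (by rw [e.apply_symm_apply]; exact ⟨_, rfl⟩)
        exact ⟨x, by rw [LinearMap.comp_apply, hx]; simp⟩))
    refine ⟨e', he', fun y => ?_, hcard⟩
    rw [← F.exact_d, ← G.exact_d, hpq]
    exact e.map_eq_zero_iff.symm

/-- The graded Betti numbers of a homogeneous ideal do not depend on the resolution. -/
theorem MinimalGradedFreeResolution.betti_eq (F G : MinimalGradedFreeResolution I)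
    (hI : ∀ p ∈ I, ∀ n, component n p ∈ I) (i : ℕ) (j : ℤ) : F.betti i j = G.betti i j := by
  obtain ⟨-, -, -, h⟩ := F.exists_graded_equiv G hI i
  exact h j

end Betti

/-! ### Regularity from the Taylor resolution -/

section TaylorRegularity

open MvPolynomial

variable {σ k L : Type*} [Field k] [Fintype L] (a : L → σ →₀ ℕ)

/-- The regularity of a monomial ideal none of whose generators divides the least common multiple
of others can be read off from the degrees of the least common multiples. -/
theorem hasRegularity_monomialIdeal (ha : ∀ (S : Finset L) (r : L), r ∉ S → ¬ a r ≤ S.sup a)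
    {n : ℤ} (hn : IsGreatest {s : ℤ | ∃ S : Finset L, s = (S.sup a).degree - S.card} n) :
    HasRegularity (monomialIdeal k a) n := by
  classical
  let _ : LinearOrder L := LinearOrder.lift' (Fintype.equivFin L) (Equiv.injective _)
  refine ⟨⟨taylorResolution a ha⟩, fun F => ?_⟩
  have hI : ∀ p ∈ monomialIdeal k a, ∀ n, component n p ∈ monomialIdeal k a := by
    intro p hp n
    rw [mem_monomialIdeal] at hp ⊢
    exact fun v hv => hp v (mem_support_monomialFilter.mp hv).2
  convert hn using 1
  ext s
  simp only [Set.mem_ofPred_eq]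
  constructor
  · rintro ⟨i, j, hij, rfl⟩
    rw [F.betti_eq (taylorResolution a ha) hI] at hij
    obtain ⟨⟨c, hc⟩⟩ := Fintype.card_pos_iff.mp (Nat.pos_of_ne_zero hij)
    refine ⟨((faceEquiv L i).symm c).1, ?_⟩
    rw [((faceEquiv L i).symm c).2, ← hc]
    rfl
  · rintro ⟨S, rfl⟩
    refine ⟨S.card, (S.sup a).degree, ?_, rfl⟩
    rw [F.betti_eq (taylorResolution a ha) hI]
    refine (Fintype.card_pos_iff.mpr ⟨⟨faceEquiv L S.card ⟨S, rfl⟩, ?_⟩⟩).ne'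
    simp [taylorResolution]

end TaylorRegularity

/-! ### Squarefree monomial ideals -/

section Squarefree

open MvPolynomial

variable {V : Type*}

/-- The exponent vector of the squarefree monomial with variables in `P`. -/
noncomputable def indicatorExponent (P : Finset V) : V →₀ ℕ := ∑ x ∈ P, Finsupp.single x 1

lemma degree_indicatorExponent (P : Finset V) : (indicatorExponent P).degree = P.card := by
  simp [indicatorExponent, map_sum]

lemma monomial_indicatorExponent {k : Type*} [Field k] (P : Finset V) :
    monomial (indicatorExponent P) (1 : k) = ∏ x ∈ P, X x := by
  rw [indicatorExponent, monomial_sum_one]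
  rfl

variable [DecidableEq V]

lemma indicatorExponent_apply (P : Finset V) (x : V) :
    indicatorExponent P x = if x ∈ P then 1 else 0 := by
  simp [indicatorExponent, Finsupp.finsetSum_apply, Finsupp.single_apply]

lemma indicatorExponent_le_iff {P Q : Finset V} :
    indicatorExponent P ≤ indicatorExponent Q ↔ P ⊆ Q := by
  constructor
  · intro h x hx
    have := h x
    rw [indicatorExponent_apply, indicatorExponent_apply, if_pos hx] at this
    by_contra hQ
    simp [hQ] at this
  · intro h x
    rw [indicatorExponent_apply, indicatorExponent_apply]
    by_cases hx : x ∈ P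
    · simp [hx, h hx]
    · simp [hx]

lemma sup_indicatorExponent {L : Type*} (S : Finset L) (P : L → Finset V) :
    S.sup (fun s => indicatorExponent (P s)) = indicatorExponent (S.biUnion P) := by
  classical
  induction S using Finset.induction_on with
  | empty => rfl
  | insert s S _ ih =>
    rw [Finset.sup_insert, ih, Finset.biUnion_insert]
    ext x
    rw [Finsupp.sup_apply]
    simp only [indicatorExponent_apply, Finset.mem_union]
    by_cases h1 : x ∈ P s <;> by_cases h2 : x ∈ S.biUnion P <;> simp [h1, h2]

end Squarefree

/-! ### Directed paths in a rooted tree -/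

namespace RootedTree

variable {V : Type*} (Γ : RootedTree V)

lemma level_root : Γ.level Γ.root = 0 := SimpleGraph.dist_self

lemma exists_dirEdge_of_ne_root {x : V} (hx : x ≠ Γ.root) : ∃ y, Γ.DirEdge y x := by
  have hconn := Γ.isTree.connected
  obtain ⟨p, hp⟩ := hconn.exists_walk_length_eq_dist x Γ.root
  cases p with
  | nil => exact absurd rfl hx
  | @cons _ y _ h q =>
    refine ⟨y, h.symm, ?_⟩
    rw [SimpleGraph.Walk.length_cons] at hp
    have h1 : Γ.level y ≤ q.length := by
      rw [level, SimpleGraph.dist_comm]; exact SimpleGraph.dist_le q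
    have h2 : Γ.level x ≤ Γ.level y + 1 := by
      have := hconn.dist_triangle (u := Γ.root) (v := y) (w := x)
      rwa [SimpleGraph.dist_eq_one_iff_adj.mpr h.symm] at this
    have h3 : Γ.level x = q.length + 1 := by rw [level, SimpleGraph.dist_comm, hp]
    omega

/-- A vertex has at most one parent, since shortest paths from the root through two parents are
two paths in a tree with the same ends. -/
lemma DirEdge.left_unique {x y z : V} (hy : Γ.DirEdge y x) (hz : Γ.DirEdge z x) : y = z := by
  have hpath : ∀ w, Γ.DirEdge w x → ∃ (p : Γ.graph.Walk Γ.root w) (h : Γ.graph.Adj w x),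
      (p.concat h).IsPath := by
    intro w hw
    obtain ⟨p, hp⟩ := Γ.isTree.connected.exists_walk_length_eq_dist Γ.root w
    refine ⟨p, hw.1, SimpleGraph.Walk.isPath_of_length_eq_dist _ ?_⟩
    rw [SimpleGraph.Walk.length_concat, hp]
    exact hw.2.symm
  obtain ⟨p, hp, hp'⟩ := hpath y hy
  obtain ⟨q, hq, hq'⟩ := hpath z hz
  have := (Γ.isTree.existsUnique_path Γ.root x).unique hp' hq'
  exact (SimpleGraph.Walk.concat_inj this).1

open Classical in
/-- The parent of a vertex; by convention the root is its own parent. -/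
noncomputable def parent (x : V) : V :=
  if h : ∃ y, Γ.DirEdge y x then h.choose else x

lemma dirEdge_parent {x : V} (hx : Γ.level x ≠ 0) : Γ.DirEdge (Γ.parent x) x := by
  have h : ∃ y, Γ.DirEdge y x :=
    Γ.exists_dirEdge_of_ne_root fun h => hx (h ▸ Γ.level_root)
  rw [parent, dif_pos h]
  exact h.choose_spec

lemma level_iterate_parent {z : V} {j : ℕ} (hj : j ≤ Γ.level z) :
    Γ.level (Γ.parent^[j] z) = Γ.level z - j := by
  induction j with
  | zero => rfl
  | succ j ih =>
    rw [Function.iterate_succ_apply']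
    have h1 := ih (by omega)
    have := (Γ.dirEdge_parent (x := Γ.parent^[j] z) (by omega)).2
    omega

lemma IsDirPath.level_eq {t : ℕ} {p : Fin t → V} (hp : Γ.IsDirPath p) (i : ℕ) (hi : i < t) :
    Γ.level (p ⟨i, hi⟩) = Γ.level (p ⟨0, by omega⟩) + i := by
  induction i with
  | zero => rfl
  | succ i ih =>
    have := (hp.2 ⟨i, by omega⟩ ⟨i + 1, hi⟩ rfl).2
    rw [this, ih, add_assoc]

variable [Fintype V]

lemma level_le_height (x : V) : Γ.level x ≤ Γ.height := Finset.le_sup (Finset.mem_univ x)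

/-- A directed path with as many vertices as the tree has levels starts at the root. -/
lemma IsDirPath.level_eq_val {p : Fin (Γ.height + 1) → V} (hp : Γ.IsDirPath p)
    (i : Fin (Γ.height + 1)) : Γ.level (p i) = i := by
  have h1 := hp.level_eq Γ i i.2
  have h2 := hp.level_eq Γ Γ.height (by omega)
  have h3 := Γ.level_le_height (p ⟨Γ.height, by omega⟩)
  rw [h1]
  omega

/-- A directed path from the root to a vertex of maximal level consists of the iterated parents of
its last vertex. -/
lemma IsDirPath.eq_iterate_parent {p : Fin (Γ.height + 1) → V} (hp : Γ.IsDirPath p) (j : ℕ)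
    (hj : j ≤ Γ.height) :
    p ⟨Γ.height - j, by omega⟩ = Γ.parent^[j] (p (Fin.last Γ.height)) := by
  induction j with
  | zero => rfl
  | succ j ih =>
    rw [Function.iterate_succ_apply', ← ih (by omega)]
    refine DirEdge.left_unique Γ (hp.2 _ _ ?_) (Γ.dirEdge_parent ?_)
    · simp only
      omega
    · rw [hp.level_eq_val]
      simp only
      omega

lemma IsDirPath.eq_of_last_eq {p q : Fin (Γ.height + 1) → V} (hp : Γ.IsDirPath p)
    (hq : Γ.IsDirPath q) (h : p (Fin.last Γ.height) = q (Fin.last Γ.height)) : p = q := by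
  funext i
  have hi : i = ⟨Γ.height - (Γ.height - i), by omega⟩ := Fin.ext (by simp only; omega)
  rw [hi, hp.eq_iterate_parent Γ _ (by omega), hq.eq_iterate_parent Γ _ (by omega), h]

lemma isDirPath_iterate_parent {z : V} (hz : Γ.level z = Γ.height) :
    Γ.IsDirPath fun i : Fin (Γ.height + 1) => Γ.parent^[Γ.height - i] z := by
  have hlev : ∀ i : Fin (Γ.height + 1), Γ.level (Γ.parent^[Γ.height - i] z) = i := by
    intro i
    rw [Γ.level_iterate_parent (by omega)]
    omega
  constructor
  · intro i j hij
    have := congrArg Γ.level hij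
    simp only [hlev] at this
    exact Fin.ext this
  · intro i j hij
    have h : Γ.height - i = Γ.height - j + 1 := by omega
    simp only [h, Function.iterate_succ_apply']
    exact Γ.dirEdge_parent (by rw [hlev]; omega)

/-- In a perfect tree every vertex is an ancestor of a vertex of maximal level. -/
lemma IsPerfect.exists_descendant (hΓ : Γ.IsPerfect) (x : V) :
    ∃ z, Γ.level z = Γ.height ∧ Γ.parent^[Γ.height - Γ.level x] z = x := by
  induction hn : Γ.height - Γ.level x generalizing x with
  | zero =>
    have := Γ.level_le_height x
    exact ⟨x, by omega, rfl⟩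
  | succ n ih =>
    have hx : Γ.outdegree x ≠ 0 := fun h => by
      have := hΓ x h
      omega
    obtain ⟨y, hy⟩ := Set.nonempty_of_ncard_ne_zero hx
    have hy' : Γ.DirEdge x y := hy
    obtain ⟨z, hz, hzy⟩ := ih y (by rw [hy'.2]; omega)
    refine ⟨z, hz, ?_⟩
    rw [Function.iterate_succ_apply', hzy]
    exact DirEdge.left_unique Γ (Γ.dirEdge_parent (by rw [hy'.2]; omega)) hy'

open Classical in
/-- The vertices of non-maximal level are the root and the children of the vertices two or more
levels above the bottom. -/
lemma card_level_lt_height (hheight : 1 ≤ Γ.height) :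
    (Finset.univ.filter fun x => Γ.level x < Γ.height).card =
      1 + ∑ x ∈ Finset.univ.filter (fun x => Γ.level x + 2 ≤ Γ.height), Γ.outdegree x := by
  have hset : (Finset.univ.filter fun x => Γ.level x < Γ.height) =
      insert Γ.root ((Finset.univ.filter fun x => Γ.level x + 2 ≤ Γ.height).biUnion
        fun x => Finset.univ.filter (Γ.DirEdge x)) := by
    ext y
    simp only [Finset.mem_filter_univ, Finset.mem_insert, Finset.mem_biUnion]
    constructor
    · intro hy
      by_cases hr : y = Γ.root
      · exact Or.inl hr
      · obtain ⟨x, hx⟩ := Γ.exists_dirEdge_of_ne_root hr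
        have := hx.2
        exact Or.inr ⟨x, by omega, hx⟩
    · rintro (rfl | ⟨x, hx, hxy⟩)
      · rw [level_root]; omega
      · have := hxy.2
        omega
  rw [hset, Finset.card_insert_of_notMem, Finset.card_biUnion, add_comm]
  · congr 1
    refine Finset.sum_congr rfl fun x _ => ?_
    rw [outdegree, ← Set.ncard_coe_finset]
    simp
  · intro x _ y _ hxy
    rw [Function.onFun, Finset.disjoint_left]
    intro z hz hz'
    simp only [Finset.mem_filter_univ] at hz hz'
    exact hxy (DirEdge.left_unique Γ hz hz')
  · simp only [Finset.mem_biUnion, Finset.mem_filter_univ, not_exists, not_and]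
    intro x _ hx
    have := hx.2
    rw [level_root] at this
    omega

/-- The directed paths from the root to the vertices of maximal level. -/
abbrev FullPath : Type _ := {p : Fin (Γ.height + 1) → V // Γ.IsDirPath p}

open Classical in
/-- The vertex set of a directed path from the root to a vertex of maximal level. -/
noncomputable def FullPath.vertices (p : Γ.FullPath) : Finset V := Finset.univ.image p.1

lemma FullPath.mem_vertices {p : Γ.FullPath} {x : V} :
    x ∈ FullPath.vertices Γ p ↔ ∃ i, p.1 i = x := by
  simp [FullPath.vertices]

/-- The last vertex of a path belongs to no other path. -/
lemma FullPath.eq_of_last_mem {p q : Γ.FullPath}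
    (h : p.1 (Fin.last Γ.height) ∈ FullPath.vertices Γ q) : p = q := by
  obtain ⟨i, hi⟩ := (FullPath.mem_vertices Γ).mp h
  have h1 := q.2.level_eq_val Γ i
  rw [hi, p.2.level_eq_val Γ] at h1
  have h2 : i = Fin.last Γ.height := Fin.ext h1.symm
  exact Subtype.ext (p.2.eq_of_last_eq Γ q.2 (by rw [← hi, h2]))

lemma pathIdeal_eq_monomialIdeal (k : Type*) [Field k] :
    Γ.pathIdeal k (Γ.height + 1) =
      monomialIdeal k fun p : Γ.FullPath => indicatorExponent (FullPath.vertices Γ p) := by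
  classical
  have hprod : ∀ p : Γ.FullPath, ∏ i, MvPolynomial.X (p.1 i) =
      MvPolynomial.monomial (indicatorExponent (FullPath.vertices Γ p)) (1 : k) := by
    intro p
    rw [monomial_indicatorExponent, FullPath.vertices, Finset.prod_image p.2.1.injOn]
  rw [pathIdeal, monomialIdeal]
  congr 1
  ext m
  constructor
  · rintro ⟨p, hp, rfl⟩
    exact ⟨_, ⟨⟨p, hp⟩, rfl⟩, (hprod ⟨p, hp⟩).symm⟩
  · rintro ⟨_, ⟨p, rfl⟩, rfl⟩
    exact ⟨p.1, p.2, (hprod p).symm⟩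

open Classical in
/-- A union of paths has at most one vertex of maximal level for each path. -/
lemma card_biUnion_vertices_le (S : Finset Γ.FullPath) :
    (S.biUnion (FullPath.vertices Γ)).card ≤
      (Finset.univ.filter fun x => Γ.level x < Γ.height).card + S.card := by
  have hsub : S.biUnion (FullPath.vertices Γ) ⊆
      (Finset.univ.filter fun x => Γ.level x < Γ.height) ∪
        S.image fun p => p.1 (Fin.last Γ.height) := by
    intro x hx
    obtain ⟨p, hp, hxp⟩ := Finset.mem_biUnion.mp hx
    obtain ⟨i, rfl⟩ := (FullPath.mem_vertices Γ).mp hxp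
    rw [Finset.mem_union, Finset.mem_filter_univ, p.2.level_eq_val Γ, Finset.mem_image]
    rcases Nat.lt_or_ge i Γ.height with h | h
    · exact Or.inl h
    · refine Or.inr ⟨p, hp, congrArg p.1 (Fin.ext ?_)⟩
      rw [Fin.val_last]
      omega
  exact (Finset.card_le_card hsub).trans
    ((Finset.card_union_le _ _).trans (Nat.add_le_add_left Finset.card_image_le _))

open Classical in
/-- The paths of a perfect tree together cover it. -/
lemma card_biUnion_vertices_univ (hΓ : Γ.IsPerfect) :
    ((Finset.univ : Finset Γ.FullPath).biUnion (FullPath.vertices Γ)).card =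
      (Finset.univ.filter fun x => Γ.level x < Γ.height).card +
        (Finset.univ : Finset Γ.FullPath).card := by
  have hcover : (Finset.univ : Finset Γ.FullPath).biUnion (FullPath.vertices Γ) =
      Finset.univ := by
    rw [Finset.eq_univ_iff_forall]
    intro x
    obtain ⟨z, hz, hzx⟩ := hΓ.exists_descendant Γ x
    rw [Finset.mem_biUnion]
    have := Γ.level_le_height x
    exact ⟨⟨_, Γ.isDirPath_iterate_parent hz⟩, Finset.mem_univ _, (FullPath.mem_vertices Γ).mpr
      ⟨⟨Γ.level x, by omega⟩, hzx⟩⟩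
  have hlast : (Finset.univ : Finset Γ.FullPath).card =
      (Finset.univ.filter fun x => ¬ Γ.level x < Γ.height).card := by
    refine Finset.card_bij (fun p _ => p.1 (Fin.last Γ.height)) ?_ ?_ ?_
    · intro p _
      rw [Finset.mem_filter_univ, p.2.level_eq_val Γ]
      simp
    · intro p _ q _ hpq
      exact Subtype.ext (p.2.eq_of_last_eq Γ q.2 hpq)
    · intro z hz
      rw [Finset.mem_filter_univ] at hz
      have hz' : Γ.level z = Γ.height := le_antisymm (Γ.level_le_height z) (not_lt.mp hz)
      exact ⟨⟨_, Γ.isDirPath_iterate_parent hz'⟩, Finset.mem_univ _, by simp⟩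
  rw [hcover, hlast, Finset.card_filter_add_card_filter_not]

end RootedTree
end PathIdeal

theorem mainTheorem9 {k : Type*} [Field k] {V : Type*} [Fintype V]
    (Γ : PathIdeal.RootedTree V) (hperfect : Γ.IsPerfect) (hheight : 1 ≤ Γ.height)
    (t : ℕ) (ht : t = Γ.height + 1) :
    PathIdeal.HasRegularity (Γ.pathIdeal k t)
      (1 + ∑ x ∈ Finset.univ.filter (fun x : V => Γ.level x + 2 ≤ Γ.height),
        (Γ.outdegree x : ℤ)) := by
  classical
  subst ht
  rw [Γ.pathIdeal_eq_monomialIdeal k]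
  have hcard := Γ.card_level_lt_height hheight
  refine PathIdeal.hasRegularity_monomialIdeal _ ?_ ⟨⟨Finset.univ, ?_⟩, ?_⟩
  · intro S p hp hle
    rw [PathIdeal.sup_indicatorExponent, PathIdeal.indicatorExponent_le_iff] at hle
    have hmem := hle ((PathIdeal.RootedTree.FullPath.mem_vertices Γ).mpr ⟨Fin.last Γ.height, rfl⟩)
    obtain ⟨q, hq, hpq⟩ := Finset.mem_biUnion.mp hmem
    exact hp (PathIdeal.RootedTree.FullPath.eq_of_last_mem Γ hpq ▸ hq)
  · rw [PathIdeal.sup_indicatorExponent, PathIdeal.degree_indicatorExponent,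
      Γ.card_biUnion_vertices_univ hperfect, hcard]
    push_cast
    ring
  · rintro _ ⟨S, rfl⟩
    have hle := Γ.card_biUnion_vertices_le S
    rw [hcard] at hle
    rw [PathIdeal.sup_indicatorExponent, PathIdeal.degree_indicatorExponent]
    have hle' : ((S.biUnion (PathIdeal.RootedTree.FullPath.vertices Γ)).card : ℤ) ≤
        1 + ∑ x ∈ Finset.univ.filter (fun x : V => Γ.level x + 2 ≤ Γ.height),
          (Γ.outdegree x : ℤ) + S.card := by exact_mod_cast hle
    linarith
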